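/- Let $(\mathcal X,d)$ be a compact metric space with its Borel $\sigma$-algebra and let $\omega$ be a Borel probability measure on $\mathcal X$ that is not purely atomic, i.e. $\omega(\{x\in\mathcal X:\omega(\{x\})=0\})>0$ (for instance any non-atomic $\omega$). Let $1<p<\infty$, $p\neq 2$. Let $$\Omega=\{F:\mathcal X\to\mathcal X \text{ measurable},\ F_\#\omega=\omega\},\qquad \Lambda=\{\mathrm{ev}_x: F\mapsto F(x)\mid x\in\mathcal X\},$$ where the elements of $\Omega$ are functions, not classes modulo null sets. Let $\mathcal K_F f=f\circ F$ be the Koopman operator on $L^p(\mathcal X,\omega)$ (complex-valued functions), and let $$\Xi(F)=\sigma_{\mathrm{ap}}(\mathcal K_F)=\{\lambda\in\mathbb C:\ \exists (f_n)\subset L^p(\mathcal X,\omega),\ \|f_n\|_p=1,\ \|(\mathcal K_F-\lambda)f_n\|_p\to 0\},$$ an element of the space $\mathcal M_{\mathrm H}$ of non-empty compact subsets of $\mathbb C$ with the Hausdorff metric. For a set $\Omega$, a metric space $\mathcal M$, a map $\Xi:\Omega\to\mathcal M$ and a set $\Lambda$ of functions on $\Omega$, a *general algorithm* is a map $\Gamma:\Omega\to\mathcal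 M$ such that to every $A\in\Omega$ there is a non-empty finite set $\Lambda_\Gamma(A)\subset\Lambda$ with the following property: if $B\in\Omega$ and $f(A)=f(B)$ for all $f\in\Lambda_\Gamma(A)$, then $\Lambda_\Gamma(A)=\Lambda_\Gamma(B)$ and $\Gamma(A)=\Gamma(B)$. A *general tower of height $k$* for $\{\Xi,\Omega,\mathcal M,\Lambda\}$ is a family of maps $\Gamma_{n_k},\Gamma_{n_k,n_{k-1}},\dots,\Gamma_{n_k,\dots,n_1}:\Omega\to\mathcal M$, indexed by natural numbers, such that the maps $\Gamma_{n_k,\dots,n_1}$ are general algorithms and, pointwise on $\Omega$, $\Xi=\lim_{n_k\to\infty}\Gamma_{n_k}$, $\Gamma_{n_k}=\lim_{n_{k-1}\to\infty}\Gamma_{n_k,n_{k-1}}$, $\dots$, $\Gamma_{n_k,\dots,n_2}=\lim_{n_1\to\infty}\Gamma_{n_k,\dots,n_1}$ (for $k=0$: $\Xi$ is itself a general algorithm). $\mathrm{SCI}_G$ is the least height of a general tower ($\infty$ if there is none), and $\Delta_3^G$ is the class of problems with $\mathrm{SCI}_G\le 2$. If the functions in $\Lambda$ take values in a metric space with metric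 $d_\Lambda$ and $\Lambda$ separates inputs with different values of $\Xi$, the problem with *$\Delta_1$-information*, $\{\Xi,\Omega,\mathcal M,\Lambda\}^{\Delta_1}$, has as inputs all tuples $(a_{f,n})_{f\in\Lambda,n\in\mathbb N}$ for which some $A\in\Omega$ satisfies $d_\Lambda(a_{f,n},f(A))\le 2^{-n}$ for all $f,n$; its problem function sends such a tuple to $\Xi(A)$, and its evaluations are the coordinate functions $(a_{f,n})\mapsto a_{f,n}$. Then $$\{\Xi,\Omega,\mathcal M_{\mathrm H},\Lambda\}^{\Delta_1}\notin\Delta_3^G\qquad\text{and}\qquad \mathrm{SCI}_G(\Xi,\Omega,\mathcal M_{\mathrm H},\Lambda)\ge 3;$$ in particular, no general tower of height $2$ computes $\sigma_{\mathrm{ap}}(\mathcal K_F)$ from point evaluations of $F$. -/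

import Mathlib

open MeasureTheory Filter Topology TopologicalSpace
open scoped ENNReal

/-! ### Computational problems, general algorithms, towers, and the SCI -/

/-- A computational problem with primary set `Ω`, target space `M`, problem function `Ξ : Ω → M` and
a set `Λ` of evaluation functions on `Ω` with values in `V`. The field `consistent` is the
consistency axiom: evaluations separate inputs with different values of `Ξ`. -/
structure CompProblem (Ω M V : Type*) where
  Ξ : Ω → M
  Λ : Set (Ω → V)
  consistent : ∀ A B : Ω, Ξ A ≠ Ξ B → ∃ f ∈ Λ, f A ≠ f B

namespace CompProblem

variable {Ω M V : Type*}

/-- `Γ` is a general algorithm for `P`: to every input `A` there is a non-empty finite set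
`Q A ⊆ Λ` of evaluations such that both `Q A` and the output `Γ A` are determined by the values on
`A` of the evaluations in `Q A`. -/
def IsGeneralAlgorithm (P : CompProblem Ω M V) (Γ : Ω → M) : Prop :=
  ∃ Q : Ω → Finset (Ω → V),
    (∀ A, (Q A).Nonempty ∧ ∀ f ∈ Q A, f ∈ P.Λ) ∧
    ∀ A B, (∀ f ∈ Q A, f A = f B) → Q A = Q B ∧ Γ A = Γ B

/-- A general tower of algorithms of height `k` for `P`. The function usually written
`Γ_{n_k, …, n_j}` is `Γ [n_k, …, n_j]` here: lists of full length `k` index the base level, which consists of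
general algorithms, every function with a shorter index is the pointwise limit of the next level,
and the function with the empty index is `Ξ`. For `k = 0` this says that `Ξ` itself is a general
algorithm. -/
structure GeneralTower [MetricSpace M] (P : CompProblem Ω M V) (k : ℕ) where
  Γ : List ℕ → Ω → M
  base : ∀ l : List ℕ, l.length = k → P.IsGeneralAlgorithm (Γ l)
  lim : ∀ l : List ℕ, l.length < k → ∀ A : Ω,
    Tendsto (fun n : ℕ => Γ (l ++ [n]) A) atTop (𝓝 (Γ l A))
  top : Γ [] = P.Ξ

/-- The solvability complexity index with respect to general towers: the least height of a general
tower for `P`, and `⊤` if there is none. -/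
noncomputable def SCI [MetricSpace M] (P : CompProblem Ω M V) : ℕ∞ :=
  sInf {h : ℕ∞ | ∃ k : ℕ, h = k ∧ Nonempty (P.GeneralTower k)}

/-- The classes `Δ_m^G` of the SCI hierarchy: `Δ_0` means `SCI = 0`, `Δ_1` means computability by one
sequence of general algorithms with error at most `2^{-n}`, and `Δ_{m+1}` for `m ≥ 1` means
`SCI ≤ m`. -/
def MemDeltaG [MetricSpace M] (P : CompProblem Ω M V) : ℕ → Prop
  | 0 => P.SCI = 0
  | 1 => ∃ Γ : ℕ → Ω → M, (∀ n, P.IsGeneralAlgorithm (Γ n)) ∧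
      ∀ n A, dist (Γ n A) (P.Ξ A) ≤ (1 / 2 : ℝ) ^ n
  | m + 2 => P.SCI ≤ (m + 1 : ℕ)

/-- `a` is `Δ_1`-information on the input `A`: the entry `a f n` approximates the evaluation `f A`
with error at most `2^{-n}`. -/
def IsDeltaOneInfo [MetricSpace V] (P : CompProblem Ω M V) (a : P.Λ → ℕ → V) (A : Ω) : Prop :=
  ∀ (f : P.Λ) (n : ℕ), dist (a f n) (f.1 A) ≤ (1 / 2 : ℝ) ^ n

/-- The primary set of the problem with `Δ_1`-information: all tuples that are `Δ_1`-information on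
some input. -/
abbrev DeltaOneInput [MetricSpace V] (P : CompProblem Ω M V) : Type _ :=
  {a : P.Λ → ℕ → V // ∃ A : Ω, P.IsDeltaOneInfo a A}

/-- The problem function does not depend on the input that the information is about. -/
theorem IsDeltaOneInfo.unique [MetricSpace V] {P : CompProblem Ω M V} {a : P.Λ → ℕ → V} {A B : Ω}
    (hA : P.IsDeltaOneInfo a A) (hB : P.IsDeltaOneInfo a B) : P.Ξ A = P.Ξ B := by
  by_contra h
  obtain ⟨f, hf, hne⟩ := P.consistent A B h
  apply hne
  have h0 : Tendsto (fun n : ℕ => (1 / 2 : ℝ) ^ n) atTop (𝓝 0) :=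
    tendsto_pow_atTop_nhds_zero_of_lt_one (by norm_num) (by norm_num)
  have h1 : Tendsto (fun n => a ⟨f, hf⟩ n) atTop (𝓝 (f A)) :=
    tendsto_iff_dist_tendsto_zero.2
      (squeeze_zero (fun _ => dist_nonneg) (hA ⟨f, hf⟩) h0)
  have h2 : Tendsto (fun n => a ⟨f, hf⟩ n) atTop (𝓝 (f B)) :=
    tendsto_iff_dist_tendsto_zero.2
      (squeeze_zero (fun _ => dist_nonneg) (hB ⟨f, hf⟩) h0)
  exact tendsto_nhds_unique h1 h2

/-- The computational problem with `Δ_1`-information: inputs are all tuples of approximations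
`a f n` to the evaluations, the evaluation functions read off one entry `a f n`, and the
problem function is `Ξ A` for any `A` that `a` is information on. -/
noncomputable def deltaOne [MetricSpace V] (P : CompProblem Ω M V) :
    CompProblem P.DeltaOneInput M V where
  Ξ := fun a => P.Ξ a.2.choose
  Λ := Set.range fun (j : P.Λ × ℕ) (a : P.DeltaOneInput) => a.1 j.1 j.2
  consistent := by
    intro a b h
    by_contra hc
    push Not at hc
    apply h
    have hab : a = b := by
      apply Subtype.ext
      funext f n
      exact hc _ ⟨(f, n), rfl⟩
    rw [hab]

theorem deltaOne_apply [MetricSpace V] (P : CompProblem Ω M V) (a : P.DeltaOneInput) (A : Ω)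
    (h : P.IsDeltaOneInfo a.1 A) : P.deltaOne.Ξ a = P.Ξ A :=
  IsDeltaOneInfo.unique a.2.choose_spec h

end CompProblem

/-! ### Approximate point spectrum -/

/-- The approximate point spectrum of a bounded operator: all `z` for which there are unit vectors
`f_n` with `‖(T - z) f_n‖ → 0`. -/
def approxPointSpectrum {E : Type*} [NormedAddCommGroup E] [NormedSpace ℂ E] (T : E →L[ℂ] E) :
    Set ℂ :=
  {z | ∃ f : ℕ → E, (∀ n, ‖f n‖ = 1) ∧ Tendsto (fun n => ‖T (f n) - z • f n‖) atTop (𝓝 0)}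

theorem mem_approxPointSpectrum_iff {E : Type*} [NormedAddCommGroup E] [NormedSpace ℂ E]
    (T : E →L[ℂ] E) (z : ℂ) :
    z ∈ approxPointSpectrum T ↔ ∀ ε : ℝ, 0 < ε → ∃ f : E, ‖f‖ = 1 ∧ ‖T f - z • f‖ < ε := by
  constructor
  · rintro ⟨f, hf, hlim⟩ ε hε
    obtain ⟨n, hn⟩ := (hlim.eventually (gt_mem_nhds hε)).exists
    exact ⟨f n, hf n, hn⟩
  · intro h
    choose f hf hlt using fun n : ℕ => h (1 / ((n : ℝ) + 1)) (by positivity)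
    exact ⟨f, hf, squeeze_zero (fun _ => norm_nonneg _) (fun n => (hlt n).le)
      tendsto_one_div_add_atTop_nhds_zero_nat⟩

theorem isClosed_approxPointSpectrum {E : Type*} [NormedAddCommGroup E] [NormedSpace ℂ E]
    (T : E →L[ℂ] E) : IsClosed (approxPointSpectrum T) := by
  refine isClosed_of_closure_subset fun z hz => ?_
  rw [mem_approxPointSpectrum_iff]
  intro ε hε
  obtain ⟨w, hw, hzw⟩ := Metric.mem_closure_iff.1 hz (ε / 2) (by positivity)
  obtain ⟨f, hf, hlt⟩ := (mem_approxPointSpectrum_iff T w).1 hw (ε / 2) (by positivity)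
  refine ⟨f, hf, ?_⟩
  have h1 : T f - z • f = (T f - w • f) - (z - w) • f := by
    rw [sub_smul]; abel
  have h2 : ‖(z - w) • f‖ = dist z w := by
    rw [norm_smul, hf, mul_one, dist_eq_norm]
  rw [h1]
  calc ‖(T f - w • f) - (z - w) • f‖ ≤ ‖T f - w • f‖ + ‖(z - w) • f‖ := norm_sub_le _ _
    _ < ε := by rw [h2]; linarith

theorem norm_le_of_mem_approxPointSpectrum {E : Type*} [NormedAddCommGroup E] [NormedSpace ℂ E]
    (T : E →L[ℂ] E) {z : ℂ} (hz : z ∈ approxPointSpectrum T) : ‖z‖ ≤ ‖T‖ := by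
  refine le_of_forall_pos_le_add fun ε hε => ?_
  obtain ⟨f, hf, hlt⟩ := (mem_approxPointSpectrum_iff T z).1 hz ε hε
  have h1 : ‖z • f‖ ≤ ‖T f‖ + ‖T f - z • f‖ := by
    have := norm_sub_le (T f) (T f - z • f)
    simpa using this
  have h2 : ‖T f‖ ≤ ‖T‖ := by simpa [hf] using T.le_opNorm f
  have h3 : ‖z • f‖ = ‖z‖ := by rw [norm_smul, hf, mul_one]
  linarith

theorem isCompact_approxPointSpectrum {E : Type*} [NormedAddCommGroup E] [NormedSpace ℂ E]
    (T : E →L[ℂ] E) : IsCompact (approxPointSpectrum T) :=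
  Metric.isCompact_of_isClosed_isBounded (isClosed_approxPointSpectrum T)
    (isBounded_iff_forall_norm_le.2 ⟨‖T‖, fun _ hz => norm_le_of_mem_approxPointSpectrum T hz⟩)

/-! ### Koopman operators of measure-preserving maps -/

section Koopman

variable {X : Type*} [MeasurableSpace X]

/-- The class of measurable measure-preserving maps `F : X → X` (functions, not classes modulo null
sets). -/
abbrev MPMap (ω : Measure X) : Type _ := {F : X → X // MeasurePreserving F ω ω}

/-- The Koopman operator `f ↦ f ∘ F` on `L^p(X, ω)`. -/
noncomputable def koopman (p : ℝ≥0∞) [Fact (1 ≤ p)] (ω : Measure X) (F : MPMap ω) :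
    Lp ℂ p ω →L[ℂ] Lp ℂ p ω :=
  (Lp.compMeasurePreservingₗᵢ ℂ F.1 F.2).toContinuousLinearMap

theorem koopman_ae_eq (p : ℝ≥0∞) [Fact (1 ≤ p)] (ω : Measure X) (F : MPMap ω) (f : Lp ℂ p ω) :
    koopman p ω F f =ᵐ[ω] fun x => f (F.1 x) :=
  Lp.coeFn_compMeasurePreserving f F.2

theorem approxPointSpectrum_koopman_nonempty (p : ℝ≥0∞) [Fact (1 ≤ p)] (ω : Measure X)
    [IsProbabilityMeasure ω] (F : MPMap ω) : (approxPointSpectrum (koopman p ω F)).Nonempty := by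
  refine ⟨1, fun _ => Lp.const p ω (1 : ℂ), fun _ => ?_, ?_⟩
  · have hp : p ≠ 0 := (zero_lt_one.trans_le (Fact.out : 1 ≤ p)).ne'
    rw [Lp.norm_const (p := p) (μ := ω) (c := (1 : ℂ)) hp]
    simp
  · have h : koopman p ω F (Lp.const p ω (1 : ℂ)) = Lp.const p ω (1 : ℂ) := by
      apply Lp.ext
      refine (koopman_ae_eq p ω F _).trans ?_
      have h1 := Lp.coeFn_const p ω (1 : ℂ)
      have h2 := F.2.quasiMeasurePreserving.ae_eq_comp h1
      filter_upwards [h1, h2] with x hx hy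
      rw [hx]
      exact hy
    simp [h]

/-- `σ_ap(K_F)` as a point of the space of non-empty compact subsets of `ℂ`, which carries the
Hausdorff metric. -/
noncomputable def koopmanApSpectrum (p : ℝ≥0∞) [Fact (1 ≤ p)] (ω : Measure X)
    [IsProbabilityMeasure ω] (F : MPMap ω) : NonemptyCompacts ℂ where
  carrier := approxPointSpectrum (koopman p ω F)
  isCompact' := isCompact_approxPointSpectrum _
  nonempty' := approxPointSpectrum_koopman_nonempty p ω F

/-- The problem of computing `σ_ap(K_F)` on `L^p(X, ω)` from point evaluations `F ↦ F x`, for all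
measurable measure-preserving `F`. -/
noncomputable def koopmanApProblem (p : ℝ≥0∞) [Fact (1 ≤ p)] (ω : Measure X)
    [IsProbabilityMeasure ω] : CompProblem (MPMap ω) (NonemptyCompacts ℂ) X where
  Ξ := koopmanApSpectrum p ω
  Λ := Set.range fun (x : X) (F : MPMap ω) => F.1 x
  consistent := by
    intro F G h
    by_contra hc
    push Not at hc
    apply h
    have hFG : F = G := Subtype.ext (funext fun x => hc _ ⟨x, rfl⟩)
    rw [hFG]

end Koopman

/-!
On a given input, a general tower of any height consults only countably many evaluations, and they
determine every limit along the tower, hence the value of the problem function. So it is enough to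
find an input at which countably many evaluations never suffice, and this rules out towers of all
heights. The identity map is such an input: away from any given countable set of points, the
non-atomic part of `ω` contains two disjoint sets `A`, `B` of equal positive measure, and exchanging
them gives a measure-preserving `F` that agrees with the identity at the given points. The function
`1_A - 1_B` is an eigenfunction of `K_F` for the eigenvalue `-1`, while `σ_ap(K_id) ⊆ {1}`. Exact
values are themselves `Δ_1`-information, so the argument also covers inexact input.
-/

/-! ### Towers and countable determination -/

namespace CompProblem

variable {Ω M V ι : Type*} {P : CompProblem Ω M V} {A : Ω}

/-- The value of the problem function at `A` is determined by countably many evaluations: every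
input that agrees with `A` on them has the same value. A problem with a general tower, of whatever
height, has this property at every input. -/
def IsCountablyDetermined (P : CompProblem Ω M V) (A : Ω) : Prop :=
  ∃ C ⊆ P.Λ, C.Countable ∧ ∀ B, (∀ f ∈ C, f A = f B) → P.Ξ A = P.Ξ B

theorem IsCountablyDetermined.exists_countable_index (h : P.IsCountablyDetermined A)
    {e : ι → Ω → V} (he : P.Λ ⊆ Set.range e) :
    ∃ I : Set ι, I.Countable ∧ ∀ B, (∀ i ∈ I, e i A = e i B) → P.Ξ A = P.Ξ B := by
  obtain ⟨C, hCΛ, hC, hdet⟩ := h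
  have := hC.to_subtype
  choose i hi using fun f : C => he (hCΛ f.2)
  refine ⟨Set.range i, Set.countable_range i, fun B hB => hdet B fun f hf => ?_⟩
  simpa only [hi] using hB (i ⟨f, hf⟩) ⟨_, rfl⟩

section Tower

variable [MetricSpace M]

theorem GeneralTower.isCountablyDetermined {k : ℕ} (T : P.GeneralTower k) (A : Ω) :
    P.IsCountablyDetermined A := by
  choose Q hQ hQΓ using T.base
  refine ⟨⋃ (l : List ℕ) (h : l.length = k), (Q l h A : Set (Ω → V)),
    Set.iUnion₂_subset fun l h => (hQ l h A).2,
    Set.countable_iUnion fun l => Set.countable_iUnion fun h => (Q l h A).countable_toSet,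
    fun B hB => ?_⟩
  have eq_of_length_add (j : ℕ) : ∀ l : List ℕ, l.length + j = k → T.Γ l A = T.Γ l B := by
    induction j with
    | zero =>
      intro l hl
      exact (hQΓ l hl A B fun f hf => hB f (Set.mem_iUnion₂.2 ⟨l, hl, hf⟩)).2
    | succ j ih =>
      intro l hl
      have hnext (n : ℕ) : T.Γ (l ++ [n]) A = T.Γ (l ++ [n]) B :=
        ih _ (by rw [List.length_append, List.length_singleton]; omega)
      have hA := T.lim l (by omega) A
      simp only [hnext] at hA
      exact tendsto_nhds_unique hA (T.lim l (by omega) B)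
  simpa only [T.top] using eq_of_length_add k [] (zero_add k)

theorem SCI_eq_top_iff : P.SCI = ⊤ ↔ ∀ k, IsEmpty (P.GeneralTower k) := by
  rw [SCI, sInf_eq_top]
  refine ⟨fun h k => ⟨fun T => ENat.natCast_ne_top k (h k ⟨k, rfl, ⟨T⟩⟩)⟩, ?_⟩
  rintro h _ ⟨k, -, ⟨T⟩⟩
  exact ((h k).false T).elim

theorem SCI_eq_top_of_not_isCountablyDetermined (h : ¬ P.IsCountablyDetermined A) : P.SCI = ⊤ :=
  SCI_eq_top_iff.2 fun _ => ⟨fun T => h (T.isCountablyDetermined A)⟩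

end Tower

section DeltaOne

variable [MetricSpace V]

/-- The exact values of the evaluations at `A`, regarded as `Δ_1`-information on `A`. -/
def exactInfo (P : CompProblem Ω M V) (A : Ω) : P.DeltaOneInput :=
  ⟨fun f _ => f.1 A, A, fun f n => by simp⟩

theorem deltaOne_exactInfo (P : CompProblem Ω M V) (A : Ω) :
    P.deltaOne.Ξ (P.exactInfo A) = P.Ξ A :=
  P.deltaOne_apply _ A fun f n => by simp [exactInfo]

theorem IsCountablyDetermined.of_deltaOne
    (h : P.deltaOne.IsCountablyDetermined (P.exactInfo A)) : P.IsCountablyDetermined A := by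
  obtain ⟨I, hI, hdet⟩ := h.exists_countable_index subset_rfl
  refine ⟨(fun j => j.1.1) '' I, ?_, hI.image _, fun B hB => ?_⟩
  · rintro _ ⟨j, -, rfl⟩
    exact j.1.2
  · simpa only [deltaOne_exactInfo] using
      hdet (P.exactInfo B) fun j hj => hB _ (Set.mem_image_of_mem _ hj)

end DeltaOne

end CompProblem

/-! ### Transport of non-atomic measures -/

section Cdf

open ProbabilityTheory

variable (ν : Measure ℝ) [IsProbabilityMeasure ν] [NullSingletonClass ν]

theorem continuous_cdf : Continuous (cdf ν) := by
  refine continuous_iff_continuousAt.2 fun x => ?_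
  rw [(monotone_cdf ν).continuousAt_iff_leftLim_eq_rightLim, StieltjesFunction.rightLim_eq]
  have hjump : (cdf ν).measure {x} = 0 := by rw [measure_cdf, measure_singleton]
  rw [StieltjesFunction.measure_singleton, ENNReal.ofReal_eq_zero, sub_nonpos] at hjump
  exact ((monotone_cdf ν).leftLim_le le_rfl).antisymm hjump

theorem Ioo_subset_range_cdf : Set.Ioo 0 1 ⊆ Set.range (cdf ν) := by
  rw [← Set.image_univ]
  exact isPreconnected_univ.intermediate_value_Ioo (l₁ := atBot) (l₂ := atTop)
    (by simp) (by simp) (continuous_cdf ν).continuousOn (tendsto_cdf_atBot ν) (tendsto_cdf_atTop ν)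

theorem measureReal_setOf_cdf_le {t : ℝ} (ht : t ∈ Set.Icc 0 1) :
    ν.real {x | cdf ν x ≤ t} = t := by
  apply le_antisymm
  · refine le_of_forall_gt_imp_ge_of_dense fun u hu => ?_
    rcases le_or_gt 1 u with hu1 | hu1
    · exact measureReal_le_one.trans hu1
    obtain ⟨s, rfl⟩ := Ioo_subset_range_cdf ν ⟨ht.1.trans_lt hu, hu1⟩
    rw [cdf_eq_real ν s]
    exact measureReal_mono fun x hx => ((monotone_cdf ν).reflect_lt (hx.trans_lt hu)).le
  · refine le_of_forall_lt_imp_le_of_dense fun u hu => ?_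
    rcases le_or_gt u 0 with hu0 | hu0
    · exact hu0.trans measureReal_nonneg
    obtain ⟨s, rfl⟩ := Ioo_subset_range_cdf ν ⟨hu0, hu.trans_le ht.2⟩
    rw [cdf_eq_real ν s]
    exact measureReal_mono fun x hx => (monotone_cdf ν hx).trans hu.le

end Cdf

section Transport

variable {X Y : Type*} [MeasurableSpace X] [MeasurableSpace Y]

theorem exists_measurePreserving_unitInterval [StandardBorelSpace X] (μ : Measure X)
    [IsProbabilityMeasure μ] [NullSingletonClass μ] :
    ∃ φ : X → unitInterval, MeasurePreserving φ μ volume := by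
  obtain ⟨e, he⟩ := exists_measurableEmbedding_real X
  have : IsProbabilityMeasure (μ.map e) :=
    Measure.isProbabilityMeasure_map he.measurable.aemeasurable
  have : NullSingletonClass (μ.map e) := ⟨fun t => by
    rw [he.map_apply]
    exact (Set.subsingleton_singleton.preimage he.injective).measure_zero μ⟩
  let φ : X → unitInterval := fun x => ⟨ProbabilityTheory.cdf (μ.map e) (e x),
    ProbabilityTheory.cdf_nonneg _ _, ProbabilityTheory.cdf_le_one _ _⟩
  have hφ : Measurable φ :=
    ((ProbabilityTheory.monotone_cdf (μ.map e)).measurable.comp he.measurable).subtype_mk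
  have : IsProbabilityMeasure (μ.map φ) := Measure.isProbabilityMeasure_map hφ.aemeasurable
  refine ⟨φ, hφ, Measure.ext_of_Iic _ _ fun t => ?_⟩
  calc μ.map φ (Set.Iic t)
      = μ.map e {s | ProbabilityTheory.cdf (μ.map e) s ≤ t} := by
        rw [Measure.map_apply hφ measurableSet_Iic, he.map_apply]; rfl
    _ = volume (Set.Iic t) := by
        rw [← ofReal_measureReal, measureReal_setOf_cdf_le _ t.2, unitInterval.volume_Iic]

theorem exists_measurePreserving_of_isProbabilityMeasure [StandardBorelSpace X]
    [StandardBorelSpace Y] (μ : Measure X) (ν : Measure Y) [IsProbabilityMeasure μ]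
    [IsProbabilityMeasure ν] [NullSingletonClass μ] : ∃ g : X → Y, MeasurePreserving g μ ν := by
  obtain ⟨φ, hφ⟩ := exists_measurePreserving_unitInterval μ
  have := nonempty_of_isProbabilityMeasure ν
  obtain ⟨q, hq, hqν⟩ := ν.exists_measurable_map_eq
  exact ⟨q ∘ φ, (MeasurePreserving.mk hq hqν).comp hφ⟩

theorem exists_measurePreserving_of_measure_univ_eq [StandardBorelSpace X] [StandardBorelSpace Y]
    [Nonempty Y] (μ : Measure X) (ν : Measure Y) [IsFiniteMeasure μ] [NullSingletonClass μ]
    (h : μ Set.univ = ν Set.univ) : ∃ g : X → Y, MeasurePreserving g μ ν := by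
  rcases eq_or_ne μ 0 with rfl | hμ
  · obtain rfl : ν = 0 := Measure.measure_univ_eq_zero.1 (by simpa using h.symm)
    exact ⟨fun _ => Classical.arbitrary Y, measurable_const, Measure.map_zero _⟩
  have hμ0 : μ Set.univ ≠ 0 := Measure.measure_univ_ne_zero.2 hμ
  have hμt : μ Set.univ ≠ ∞ := measure_ne_top _ _
  have : IsProbabilityMeasure ((μ Set.univ)⁻¹ • μ) := ⟨by simp [ENNReal.inv_mul_cancel hμ0 hμt]⟩
  have : IsProbabilityMeasure ((μ Set.univ)⁻¹ • ν) :=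
    ⟨by simp [← h, ENNReal.inv_mul_cancel hμ0 hμt]⟩
  have : NullSingletonClass ((μ Set.univ)⁻¹ • μ) := ⟨fun x => by simp⟩
  obtain ⟨g, hg⟩ := exists_measurePreserving_of_isProbabilityMeasure
    ((μ Set.univ)⁻¹ • μ) ((μ Set.univ)⁻¹ • ν)
  refine ⟨g, ?_⟩
  simpa only [smul_smul, ENNReal.mul_inv_cancel hμ0 hμt, one_smul] using
    hg.smul_measure (μ Set.univ)

theorem exists_measurableSet_measure_eq [StandardBorelSpace X] (μ : Measure X)
    [IsFiniteMeasure μ] [NullSingletonClass μ] {c : ℝ≥0∞} (hc : c ≤ μ Set.univ) :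
    ∃ A, MeasurableSet A ∧ μ A = c := by
  obtain ⟨φ, hφ⟩ := exists_measurePreserving_of_measure_univ_eq μ
    (c • Measure.dirac true + (μ Set.univ - c) • Measure.dirac false)
    (by simp [add_tsub_cancel_of_le hc])
  refine ⟨φ ⁻¹' {true}, hφ.measurable (measurableSet_singleton _), ?_⟩
  rw [hφ.measure_preimage (measurableSet_singleton _).nullMeasurableSet]
  simp

theorem nullSingletonClass_restrict [MeasurableSingletonClass X] {μ : Measure X} {A : Set X}
    (hA : ∀ x ∈ A, μ {x} = 0) : NullSingletonClass (μ.restrict A) := by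
  refine ⟨fun x => ?_⟩
  rw [Measure.restrict_apply (measurableSet_singleton x)]
  by_cases hx : x ∈ A
  · exact measure_inter_null_of_null_left _ (hA x hx)
  · rw [Set.singleton_inter_eq_empty.2 hx, measure_empty]

theorem exists_disjoint_subset_measure_eq_half [StandardBorelSpace X] (μ : Measure X)
    [IsFiniteMeasure μ] {N : Set X} (hN : MeasurableSet N) (hnull : ∀ x ∈ N, μ {x} = 0) :
    ∃ A ⊆ N, ∃ B ⊆ N, MeasurableSet A ∧ MeasurableSet B ∧ Disjoint A B ∧
      μ A = μ N / 2 ∧ μ B = μ N / 2 := by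
  have := nullSingletonClass_restrict hnull
  obtain ⟨S, hS, hSN⟩ := exists_measurableSet_measure_eq (μ.restrict N) (c := μ N / 2)
    (by simpa using ENNReal.half_le_self)
  rw [Measure.restrict_apply hS] at hSN
  refine ⟨S ∩ N, Set.inter_subset_right, N \ S, Set.sdiff_subset, hS.inter hN, hN.diff hS,
    Set.disjoint_sdiff_right.mono_left Set.inter_subset_left, hSN, ?_⟩
  rw [← Set.sdiff_inter_self_eq_sdiff, measure_sdiff Set.inter_subset_right
    (hS.inter hN).nullMeasurableSet (measure_ne_top _ _), hSN,
    ENNReal.sub_half (measure_ne_top _ _)]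

theorem measurePreserving_piecewise {μ : Measure X} {ν₁ ν₂ : Measure Y} {S : Set X}
    [DecidablePred (· ∈ S)] {f g : X → Y} (hS : MeasurableSet S)
    (hf : MeasurePreserving f (μ.restrict S) ν₁) (hg : MeasurePreserving g (μ.restrict Sᶜ) ν₂) :
    MeasurePreserving (S.piecewise f g) μ (ν₁ + ν₂) := by
  have hm : Measurable (S.piecewise f g) := hf.measurable.piecewise hS hg.measurable
  refine ⟨hm, ?_⟩
  rw [← Measure.restrict_add_restrict_compl (μ := μ) hS, Measure.map_add _ _ hm,
    Measure.map_congr (piecewise_ae_eq_restrict hS),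
    Measure.map_congr (piecewise_ae_eq_restrict_compl hS), hf.map_eq, hg.map_eq]

theorem ae_mem_imp_of_measurePreserving_restrict {μ : Measure X} {ν : Measure Y} {S : Set X}
    {T : Set Y} {g : X → Y} (hS : MeasurableSet S) (hT : MeasurableSet T)
    (hg : MeasurePreserving g (μ.restrict S) (ν.restrict T)) : ∀ᵐ x ∂μ, x ∈ S → g x ∈ T :=
  (ae_restrict_iff' hS).1 (hg.quasiMeasurePreserving.ae (ae_restrict_mem hT))

theorem not_ae_eq_of_disjoint {μ : Measure X} {A B : Set X} (hAB : Disjoint A B) (hA : μ A ≠ 0) :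
    ¬ A =ᵐ[μ] B := by
  intro h
  apply hA
  rw [← Set.inter_self A, measure_congr (ae_eq_set_inter (ae_eq_refl A) h), hAB.inter_eq,
    measure_empty]

theorem exists_measurePreserving_swap [StandardBorelSpace X] [Nonempty X] (μ : Measure X)
    [IsFiniteMeasure μ] {A B : Set X} (hA : MeasurableSet A) (hB : MeasurableSet B)
    (hAB : Disjoint A B) (heq : μ A = μ B) (hnull : ∀ x ∈ A ∪ B, μ {x} = 0) :
    ∃ F : X → X, MeasurePreserving F μ μ ∧ Set.EqOn F id (A ∪ B)ᶜ ∧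
      F ⁻¹' A =ᵐ[μ] B ∧ F ⁻¹' B =ᵐ[μ] A := by
  classical
  have := nullSingletonClass_restrict fun x hx => hnull x (Set.mem_union_left B hx)
  have := nullSingletonClass_restrict fun x hx => hnull x (Set.mem_union_right A hx)
  obtain ⟨g, hg⟩ := exists_measurePreserving_of_measure_univ_eq (μ.restrict A) (μ.restrict B)
    (by simpa using heq)
  obtain ⟨k, hk⟩ := exists_measurePreserving_of_measure_univ_eq (μ.restrict B) (μ.restrict A)
    (by simpa using heq.symm)
  have hgAB := ae_mem_imp_of_measurePreserving_restrict hA hB hg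
  have hkBA := ae_mem_imp_of_measurePreserving_restrict hB hA hk
  have hBA : B ∩ Aᶜ = B := Set.inter_eq_left.2 hAB.subset_compl_left
  refine ⟨A.piecewise g (B.piecewise k id), ?_, ?_, ?_, ?_⟩
  · have hF := measurePreserving_piecewise hA hg (measurePreserving_piecewise hB
      (by rwa [Measure.restrict_restrict hB, hBA]) (.id ((μ.restrict Aᶜ).restrict Bᶜ)))
    convert hF using 1
    rw [Measure.restrict_restrict hB.compl, ← Set.compl_union, ← add_assoc,
      ← Measure.restrict_union hAB.symm hA, Measure.restrict_add_restrict_compl (hB.union hA)]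
  · intro x hx
    rw [Set.mem_compl_iff, Set.mem_union, not_or] at hx
    simp [hx]
  · rw [eventuallyEq_set]
    filter_upwards [hgAB, hkBA] with x hxA hxB
    rw [Set.mem_preimage]
    by_cases hx : x ∈ A
    · simp [hx, Set.disjoint_left.1 hAB hx, Set.disjoint_right.1 hAB (hxA hx)]
    by_cases hx' : x ∈ B <;> simp [hx, hx', hxB]
  · rw [eventuallyEq_set]
    filter_upwards [hgAB, hkBA] with x hxA hxB
    rw [Set.mem_preimage]
    by_cases hx : x ∈ A
    · simp [hx, hxA]
    by_cases hx' : x ∈ B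
    · simp [hx, hx', Set.disjoint_left.1 hAB (hxB hx')]
    · simp [hx, hx']

end Transport

/-! ### Spectra of Koopman operators -/

section Spectrum

variable {E : Type*} [NormedAddCommGroup E] [NormedSpace ℂ E]

theorem mem_approxPointSpectrum_of_apply_eq_smul {T : E →L[ℂ] E} {z : ℂ} {f : E} (hf : f ≠ 0)
    (h : T f = z • f) : z ∈ approxPointSpectrum T := by
  refine (mem_approxPointSpectrum_iff T z).2 fun ε hε => ⟨((‖f‖⁻¹ : ℝ) : ℂ) • f, ?_, ?_⟩
  · exact_mod_cast norm_smul_inv_norm (𝕜 := ℂ) hf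
  · rwa [map_smul, h, smul_comm, sub_self, norm_zero]

theorem approxPointSpectrum_id_subset :
    approxPointSpectrum (ContinuousLinearMap.id ℂ E) ⊆ {1} := by
  intro z hz
  suffices h : ‖1 - z‖ ≤ 0 from (sub_eq_zero.1 (norm_le_zero_iff.1 h)).symm
  refine le_of_forall_pos_le_add fun ε hε => ?_
  obtain ⟨f, hf, hlt⟩ := (mem_approxPointSpectrum_iff _ z).1 hz ε hε
  have hnorm : ‖f - z • f‖ = ‖1 - z‖ := by
    rw [← mul_one ‖1 - z‖, ← hf, ← norm_smul, sub_smul, one_smul]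
  rw [zero_add, ← hnorm]
  exact hlt.le

end Spectrum

section KoopmanSpectrum

variable {X : Type*} [MeasurableSpace X] (p : ℝ≥0∞) [Fact (1 ≤ p)] (ω : Measure X)

theorem koopman_id : koopman p ω ⟨id, .id ω⟩ = ContinuousLinearMap.id ℂ (Lp ℂ p ω) :=
  ContinuousLinearMap.ext fun f => Lp.ext (koopman_ae_eq p ω _ f)

theorem neg_one_mem_approxPointSpectrum_koopman [IsFiniteMeasure ω] (F : MPMap ω) {A B : Set X}
    (hA : MeasurableSet A) (hB : MeasurableSet B) (hne : ¬ A =ᵐ[ω] B)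
    (hFA : F.1 ⁻¹' A =ᵐ[ω] B) (hFB : F.1 ⁻¹' B =ᵐ[ω] A) :
    (-1 : ℂ) ∈ approxPointSpectrum (koopman p ω F) := by
  let h : X → ℂ := A.indicator 1 - B.indicator 1
  have hh : MemLp h p ω :=
    ((memLp_const (1 : ℂ)).indicator hA).sub ((memLp_const (1 : ℂ)).indicator hB)
  have hhF : h ∘ F.1 =ᵐ[ω] -h := by
    have hcomp : h ∘ F.1 = (F.1 ⁻¹' A).indicator 1 - (F.1 ⁻¹' B).indicator 1 := rfl
    rw [hcomp, neg_sub]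
    exact (indicator_ae_eq_of_ae_eq_set hFA).sub (indicator_ae_eq_of_ae_eq_set hFB)
  refine mem_approxPointSpectrum_of_apply_eq_smul (f := hh.toLp h) (fun h0 => hne ?_) ?_
  · have hh0 : h =ᵐ[ω] 0 := hh.coeFn_toLp.symm.trans (h0 ▸ Lp.coeFn_zero ℂ p ω)
    rw [eventuallyEq_set]
    filter_upwards [hh0] with x hx
    have hx' : A.indicator (1 : X → ℂ) x = B.indicator 1 x := sub_eq_zero.1 hx
    by_cases hxA : x ∈ A <;> by_cases hxB : x ∈ B <;> simp_all [Set.indicator]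
  · have hcomp : hh.toLp h ∘ F.1 =ᵐ[ω] h ∘ F.1 :=
      F.2.quasiMeasurePreserving.ae_eq_comp hh.coeFn_toLp
    rw [neg_one_smul, ← hh.toLp_neg]
    exact Lp.ext ((koopman_ae_eq p ω F _).trans (hcomp.trans (hhF.trans hh.neg.coeFn_toLp.symm)))

theorem measurableSet_setOf_measure_singleton_eq_zero [MeasurableSingletonClass X] [SFinite ω] :
    MeasurableSet {x | ω {x} = 0} := by
  have hatoms : {x | 0 < ω {x}}.Countable :=
    Measure.countable_meas_level_set_pos (μ := ω) (g := (id : X → X)) measurable_id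
  simpa [Set.compl_ofPred] using hatoms.measurableSet.compl

theorem exists_eqOn_id_koopmanApSpectrum_ne [StandardBorelSpace X] [IsProbabilityMeasure ω]
    (hω : ω {x | ω {x} = 0} ≠ 0) {C : Set X} (hC : C.Countable) :
    ∃ F : MPMap ω, Set.EqOn F.1 id C ∧
      koopmanApSpectrum p ω ⟨id, .id ω⟩ ≠ koopmanApSpectrum p ω F := by
  have := nonempty_of_isProbabilityMeasure ω
  have hN := (measurableSet_setOf_measure_singleton_eq_zero ω).diff hC.measurableSet
  have hN0 : ω ({x | ω {x} = 0} \ C) ≠ 0 := by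
    have := nullSingletonClass_restrict (μ := ω) (A := {x | ω {x} = 0}) fun _ hx => hx
    have hCnull := hC.measure_zero (ω.restrict {x | ω {x} = 0})
    rw [Measure.restrict_apply hC.measurableSet, Set.inter_comm] at hCnull
    rwa [measure_sdiff_null' hCnull]
  obtain ⟨A, hAN, B, hBN, hA, hB, hAB, hωA, hωB⟩ :=
    exists_disjoint_subset_measure_eq_half ω hN fun x hx => hx.1
  have hABN := Set.union_subset hAN hBN
  obtain ⟨F, hF, hFid, hFA, hFB⟩ := exists_measurePreserving_swap ω hA hB hAB
    (hωA.trans hωB.symm) fun x hx => (hABN hx).1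
  have hne : ¬ A =ᵐ[ω] B := not_ae_eq_of_disjoint hAB (hωA ▸ (ENNReal.half_pos hN0).ne')
  refine ⟨⟨F, hF⟩, hFid.mono fun x hx hxAB => (hABN hxAB).2 hx, fun hspec => ?_⟩
  have hmem : (-1 : ℂ) ∈ approxPointSpectrum (koopman p ω ⟨id, .id ω⟩) :=
    (SetLike.ext_iff.1 hspec (-1)).2
      (neg_one_mem_approxPointSpectrum_koopman p ω ⟨F, hF⟩ hA hB hne hFA hFB)
  rw [koopman_id] at hmem
  have hone : (-1 : ℂ) = 1 := approxPointSpectrum_id_subset hmem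
  norm_num at hone

theorem koopmanApProblem_not_isCountablyDetermined_id [StandardBorelSpace X]
    [IsProbabilityMeasure ω] (hω : ω {x | ω {x} = 0} ≠ 0) :
    ¬ (koopmanApProblem p ω).IsCountablyDetermined ⟨id, .id ω⟩ := by
  intro h
  obtain ⟨C, hC, hdet⟩ := h.exists_countable_index subset_rfl
  obtain ⟨F, hF, hne⟩ := exists_eqOn_id_koopmanApSpectrum_ne p ω hω hC
  exact hne (hdet F fun x hx => (hF hx).symm)

end KoopmanSpectrum

theorem theorem5p6_general {X : Type*} [MetricSpace X] [MeasurableSpace X] [StandardBorelSpace X]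
    (ω : Measure X) [IsProbabilityMeasure ω] (hω : ω {x | ω {x} = 0} ≠ 0)
    (p : ℝ≥0∞) [Fact (1 ≤ p)] :
    (koopmanApProblem p ω).deltaOne.SCI = ⊤ ∧ (koopmanApProblem p ω).SCI = ⊤ :=
  have hid := koopmanApProblem_not_isCountablyDetermined_id p ω hω
  ⟨CompProblem.SCI_eq_top_of_not_isCountablyDetermined fun h => hid h.of_deltaOne,
    CompProblem.SCI_eq_top_of_not_isCountablyDetermined hid⟩

theorem theorem5p6 {X : Type*} [MetricSpace X] [CompactSpace X] [MeasurableSpace X] [BorelSpace X]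
    (ω : Measure X) [IsProbabilityMeasure ω]
    (hω : ω {x | ω {x} = 0} ≠ 0)
    (p : ℝ≥0∞) [Fact (1 ≤ p)] (hp1 : 1 < p) (hp2 : p ≠ 2) (hp_top : p < ∞) :
    ¬ (koopmanApProblem p ω).deltaOne.MemDeltaG 3 ∧
      3 ≤ (koopmanApProblem p ω).SCI ∧
      IsEmpty ((koopmanApProblem p ω).GeneralTower 2) := by
  obtain ⟨hΔ, h⟩ := theorem5p6_general ω hω p
  exact ⟨by simp [CompProblem.MemDeltaG, hΔ], by simp [h], CompProblem.SCI_eq_top_iff.1 h 2⟩
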